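/- An (a,b)-module is a free $\mathbb{C}[[b]]$-module $E$ of finite type with a $\mathbb{C}$-linear, $b$-adically continuous endomorphism $a$ such that $ab-ba=b^2$; morphisms are the $\mathbb{C}[[b]]$-linear maps commuting with $a$. For $\lambda\in\mathbb{C}$, $E_\lambda=\mathbb{C}[[b]]e_\lambda$ is the rank one (a,b)-module with $a e_\lambda=\lambda b e_\lambda$. $E$ is regular if the smallest $\mathbb{C}[[b]]$-submodule of $E[b^{-1}]$ containing $E$ and stable by $b^{-1}a$ is finitely generated; then $or(E)$ is the smallest $k\in\mathbb{N}$ with $a^{k+1}E\subset\sum_{j=0}^{k}a^jb^{k-j+1}E$. Order each class $\tilde\lambda\in\mathbb{C}/\mathbb{Z}$ by real parts and put $\tilde\lambda_{min}(E)=\inf\{\mu\in\tilde\lambda : \exists\, E_\mu\to E \text{ a nonzero morphism}\}$, $\tilde\lambda_{max}(E)=\sup\{\mu\in\tilde\lambda : \exists\, E\to E_\mu \text{ a nonzero morphism}\}$ (with $\inf\emptyset=+\infty$, $\sup\emptyset=-\infty$, $-\infty-x=-\infty$ for $x\in{]-\infty,+\infty]}$, $+\infty-x=+\infty$ for $x\in{[-\infty,+\infty[}$),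 and let the width be $L(E)=\sup_{\tilde\lambda\in\mathbb{C}/\mathbb{Z}}\big(\tilde\lambda_{max}(E)-\tilde\lambda_{min}(E)\big)$. The dual $F^*$ of an (a,b)-module $F$ is $Hom_{\mathbb{C}[[b]]}(F,E_0)$, on which $S(b)\in\mathbb{C}[[b]]$ acts as $S(-b)$ and $(a\varphi)(x)=\varphi(ax)-a\varphi(x)$. For an (a,b)-module $G$ and $\mu\in\mathbb{C}$, $N(G,\mu)$ denotes the smallest integer such that $b^NG\subset(a-\mu b)G$ for all $N\ge N(G,\mu)$. Let $E$ be a regular (a,b)-module, let $\lambda\in\mathbb{C}$ with class $\tilde\lambda\in\mathbb{C}/\mathbb{Z}$ be such that $\lambda=\tilde\lambda_{min}(E)$, and let $$0\to E_\lambda\to E\to F\to 0$$ be a short exact sequence of (a,b)-modules. If $N\in\mathbb{N}$ satisfies $$N\ \ge\ or(E)+L(E)+rank(E)+1,$$ then $N\ge N(F^*,-\lambda)$; in particular $b^NF^*\subset(a+\lambda b)F^*$. -/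

import Mathlib

open PowerSeries

/-- The `b`-adic topology of a `ℂ[[b]]`-module (the variable `b` is `PowerSeries.X`). -/
@[reducible] noncomputable def bAdicTopology (E : Type*) [AddCommGroup E] [Module ℂ⟦X⟧ E] :
    TopologicalSpace E :=
  (Ideal.span {(X : ℂ⟦X⟧)}).adicModuleTopology E

/-- An (a,b)-module: a free `ℂ[[b]]`-module of finite type with a `ℂ`-linear endomorphism `a`,
continuous for the `b`-adic topology, such that `a b - b a = b²`. -/
class ABModule (E : Type*) [AddCommGroup E] [Module ℂ⟦X⟧ E] where
  free : Module.Free ℂ⟦X⟧ E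
  finite : Module.Finite ℂ⟦X⟧ E
  a : E →+ E
  a_const : ∀ (c : ℂ) (x : E), a ((C c : ℂ⟦X⟧) • x) = (C c : ℂ⟦X⟧) • a x
  a_continuous : @Continuous E E (bAdicTopology E) (bAdicTopology E) a
  a_b : ∀ x : E, a ((X : ℂ⟦X⟧) • x) - (X : ℂ⟦X⟧) • a x = ((X : ℂ⟦X⟧) ^ 2) • x

namespace ABModule

theorem module_aux₁ {R M : Type*} [CommRing R] [AddCommGroup M] [Module R M]
    (p P T T' n X Xn : R) (x ax bx : M) :
    p • ax + P • x + (Xn • bx + (n * (Xn * X)) • (T • x)) -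
      ((p + Xn * T) • ax + (P + Xn * (T' + n * X * T)) • x) =
    Xn • (bx + (n * X * T) • x - T • ax - (T' + n * X * T) • x) := by
  module

theorem module_aux₂ {R M : Type*} [CommRing R] [AddCommGroup M] [Module R M]
    {X u s t du ds dt : R} {x y ax ay : M} (h : (u * t) • x = (u * s) • y)
    (h' : (u * t) • ax + (X ^ 2 * (u * dt + t * du)) • x =
      (u * s) • ay + (X ^ 2 * (u * ds + s * du)) • y) :
    (u ^ 2) • (X * t ^ 2) • (s • ax - (X ^ 2 * ds) • x) =
      (u ^ 2) • (X * s ^ 2) • (t • ay - (X ^ 2 * dt) • y) := by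
  linear_combination (norm := module) (X * u * t * s) • h' -
    (X ^ 3 * (u * t * ds + u * s * dt + t * s * du)) • h

attribute [instance] ABModule.free ABModule.finite

section Basic

variable {E : Type*} [AddCommGroup E] [Module ℂ⟦X⟧ E]

/-- An additive map with `α b - b α = b²` satisfies `α bⁿ = bⁿ α + n bⁿ⁺¹`. -/
theorem comm_pow {α : E →+ E}
    (hb : ∀ x : E, α ((X : ℂ⟦X⟧) • x) - (X : ℂ⟦X⟧) • α x = ((X : ℂ⟦X⟧) ^ 2) • x)
    (n : ℕ) (x : E) :
    α ((X : ℂ⟦X⟧) ^ n • x) =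
      (X : ℂ⟦X⟧) ^ n • α x + ((n : ℂ⟦X⟧) * (X : ℂ⟦X⟧) ^ (n + 1)) • x := by
  induction n with
  | zero => simp
  | succ n ih =>
    have h := hb ((X : ℂ⟦X⟧) ^ n • x)
    rw [ih, sub_eq_iff_eq_add] at h
    rw [pow_succ', mul_smul, h]
    simp only [smul_add, smul_smul, add_assoc]
    rw [add_comm]
    simp only [add_assoc, ← add_smul]
    congr 2
    push_cast
    ring

theorem mem_span_X_pow_smul_top (n : ℕ) (x : E) :
    x ∈ (Ideal.span {(X : ℂ⟦X⟧)} ^ n • (⊤ : Submodule ℂ⟦X⟧ E)) ↔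
      ∃ y : E, x = (X : ℂ⟦X⟧) ^ n • y := by
  rw [Ideal.span_singleton_pow, Submodule.ideal_span_singleton_smul,
    Submodule.mem_smul_pointwise_iff_exists]
  simp [eq_comm]

/-- The continuity of `a` for the `b`-adic topology, from the commutation relation. -/
theorem continuous_of_comm {α : E →+ E}
    (hb : ∀ x : E, α ((X : ℂ⟦X⟧) • x) - (X : ℂ⟦X⟧) • α x = ((X : ℂ⟦X⟧) ^ 2) • x) :
    @Continuous E E (bAdicTopology E) (bAdicTopology E) α := by
  let I : Ideal ℂ⟦X⟧ := Ideal.span {(X : ℂ⟦X⟧)}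
  let _ : TopologicalSpace ℂ⟦X⟧ := I.adic_basis.topology
  let B := (I.ringFilterBasis.moduleFilterBasis (I.adic_module_basis E))
  let _ : TopologicalSpace E := bAdicTopology E
  have _ : IsTopologicalAddGroup E := B.toAddGroupFilterBasis.isTopologicalAddGroup
  have hB := B.toAddGroupFilterBasis.nhds_zero_hasBasis
  refine continuous_of_continuousAt_zero α ?_
  rw [ContinuousAt, map_zero]
  refine (hB.tendsto_iff hB).mpr ?_
  rintro _ ⟨n, rfl⟩
  refine ⟨_, ⟨n, rfl⟩, ?_⟩
  intro x hx
  obtain ⟨y, rfl⟩ := (mem_span_X_pow_smul_top n x).mp hx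
  refine (mem_span_X_pow_smul_top n _).mpr ⟨α y + ((n : ℂ⟦X⟧) * X) • y, ?_⟩
  rw [comm_pow hb, smul_add, smul_smul]
  congr 2
  ring

/-- The Leibniz rule `a S = S a + b² S'(b)` for `S ∈ ℂ[[b]]`. -/
theorem a_smul [ABModule E] (S : ℂ⟦X⟧) (x : E) :
    a (S • x) = S • a x + ((X : ℂ⟦X⟧) ^ 2 * derivative ℂ S) • x := by
  have hpow : ∀ (n : ℕ) (y : E), a ((X : ℂ⟦X⟧) ^ n • y) =
      (X : ℂ⟦X⟧) ^ n • a y + ((n : ℂ⟦X⟧) * (X : ℂ⟦X⟧) ^ (n + 1)) • y := comm_pow a_b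
  have hpoly : ∀ p : Polynomial ℂ, a ((p : ℂ⟦X⟧) • x) =
      (p : ℂ⟦X⟧) • a x + ((X : ℂ⟦X⟧) ^ 2 * derivative ℂ (p : ℂ⟦X⟧)) • x := by
    intro p
    induction p using Polynomial.induction_on' with
    | add p q hp hq =>
      rw [Polynomial.coe_add, add_smul, map_add, hp, hq, map_add, add_smul, mul_add, add_smul]
      abel
    | monomial n c =>
      have hm : ((Polynomial.monomial n c : Polynomial ℂ) : ℂ⟦X⟧) = C c * X ^ n := by
        rw [← Polynomial.C_mul_X_pow_eq_monomial]; simp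
      rw [hm, mul_smul, a_const, hpow, Derivation.leibniz, derivative_C, derivative_pow, derivative_X]
      rcases n with _ | n
      · simp
      · simp only [smul_add, smul_smul, smul_eq_mul, mul_zero, add_zero, Nat.add_sub_cancel]
        congr 2
        ring
  rw [← sub_eq_zero]
  have hbot := Ideal.iInf_pow_smul_eq_bot_of_isLocalRing (M := E) (Ideal.span {(X : ℂ⟦X⟧)})
    (by rw [Ne, Ideal.span_singleton_eq_top]; exact X_prime.not_isUnit)
  rw [← Submodule.mem_bot ℂ⟦X⟧, ← hbot, Submodule.mem_iInf]
  intro n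
  obtain ⟨T, hT⟩ : (X : ℂ⟦X⟧) ^ n ∣ S - (trunc n S : ℂ⟦X⟧) := by
    rw [X_pow_dvd_iff]
    intro m hm
    simp [coeff_trunc, hm]
  rw [sub_eq_iff_eq_add'] at hT
  refine (mem_span_X_pow_smul_top n _).mpr
    ⟨a (T • x) + ((n : ℂ⟦X⟧) * X * T) • x - T • a x
      - ((X : ℂ⟦X⟧) ^ 2 * derivative ℂ T + (n : ℂ⟦X⟧) * X * T) • x, ?_⟩
  have hd : X ^ 2 * derivative ℂ ((X : ℂ⟦X⟧) ^ n * T) =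
      X ^ n * (X ^ 2 * derivative ℂ T + (n : ℂ⟦X⟧) * X * T) := by
    rw [Derivation.leibniz, derivative_pow, derivative_X]
    rcases n with _ | n
    · simp
    · simp only [smul_eq_mul, Nat.add_sub_cancel]
      ring
  have e : (X : ℂ⟦X⟧) ^ 2 * derivative ℂ S = X ^ 2 * derivative ℂ (trunc n S : ℂ⟦X⟧) +
      X ^ n * (X ^ 2 * derivative ℂ T + (n : ℂ⟦X⟧) * X * T) := by
    rw [← hd, ← mul_add, ← map_add, ← hT]
  rw [e]
  have h1 : a (S • x) = (trunc n S : ℂ⟦X⟧) • a x +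
      ((X : ℂ⟦X⟧) ^ 2 * derivative ℂ (trunc n S : ℂ⟦X⟧)) • x +
      ((X : ℂ⟦X⟧) ^ n • a (T • x) + ((n : ℂ⟦X⟧) * ((X : ℂ⟦X⟧) ^ n * X)) • (T • x)) := by
    conv_lhs => rw [hT]
    rw [add_smul, map_add, hpoly, mul_smul (X ^ n) T x, hpow, pow_succ X n]
  have h2 : S • a x = ((trunc n S : ℂ⟦X⟧) + X ^ n * T) • a x := by rw [← hT]
  rw [h1, h2]
  exact module_aux₁ ..

end Basic

section Localization

variable (E : Type*) [AddCommGroup E] [Module ℂ⟦X⟧ E]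

/-- `E[b⁻¹]`. -/
abbrev Loc : Type _ := LocalizedModule (Submonoid.powers (X : ℂ⟦X⟧)) E

variable [ABModule E]

/-- The operator `b⁻¹ a` on `E[b⁻¹]`, where `a` is extended by the Leibniz rule
`a (s⁻¹ x) = s⁻¹ a x - b² s' s⁻² x` for `s` a power of `b`. -/
noncomputable def binvA (w : Loc E) : Loc E :=
  w.liftOn
    (fun p => LocalizedModule.mk
      ((p.2 : ℂ⟦X⟧) • a p.1 - ((X : ℂ⟦X⟧) ^ 2 * derivative ℂ (p.2 : ℂ⟦X⟧)) • p.1)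
      (⟨X, Submonoid.mem_powers _⟩ * p.2 ^ 2))
    (by
      rintro ⟨x, s, hs⟩ ⟨y, t, ht⟩ ⟨⟨u, hu⟩, h⟩
      refine LocalizedModule.mk_eq.mpr ⟨⟨u, hu⟩ ^ 2, ?_⟩
      simp only [Submonoid.smul_def, Submonoid.coe_mul, SubmonoidClass.coe_pow] at h ⊢
      have h' := congrArg (a : E →+ E) h
      simp only [a_smul, smul_smul, Derivation.leibniz, smul_eq_mul] at h h'
      exact module_aux₂ h h')

/-- The saturation `E^♯` of `E` by `b⁻¹ a` in `E[b⁻¹]`: the smallest `ℂ[[b]]`-submodule of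
`E[b⁻¹]` which contains `E` and is stable by `b⁻¹ a`. -/
noncomputable def saturation : Submodule ℂ⟦X⟧ (Loc E) :=
  sInf {W | LinearMap.range (LocalizedModule.mkLinearMap (Submonoid.powers (X : ℂ⟦X⟧)) E) ≤ W ∧
    ∀ w ∈ W, binvA E w ∈ W}

/-- `E` is regular when its saturation by `b⁻¹ a` is finitely generated over `ℂ[[b]]`. -/
def IsRegular : Prop := (saturation E).FG

/-- The regularity order: the smallest `k` with
`a^{k+1} E ⊆ ∑_{j=0}^{k} a^j b^{k-j+1} E`. -/
noncomputable def regOrder : ℕ :=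
  sInf {k : ℕ | ∀ x : E, ∃ y : ℕ → E,
    (⇑(a : E →+ E))^[k + 1] x =
      ∑ j ∈ Finset.range (k + 1), (⇑(a : E →+ E))^[j] ((X : ℂ⟦X⟧) ^ (k - j + 1) • y j)}

end Localization

/-- A `ℂ[[b]]`-linear map is a morphism of (a,b)-modules when it commutes with `a`. -/
def IsABMorphism {E F : Type*} [AddCommGroup E] [Module ℂ⟦X⟧ E] [ABModule E]
    [AddCommGroup F] [Module ℂ⟦X⟧ F] [ABModule F] (f : E →ₗ[ℂ⟦X⟧] F) : Prop :=
  ∀ x : E, f (a x) = a (f x)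

/-- The rank one (a,b)-module `E_lam = ℂ[[b]] e` with `a e = lam b e`; the element `S e` is
represented by `S`, so that `a S = lam b S + b² S'`. -/
def RankOne (_lam : ℂ) : Type := ℂ⟦X⟧

namespace RankOne

variable (lam : ℂ)

noncomputable instance : AddCommGroup (RankOne lam) := inferInstanceAs (AddCommGroup ℂ⟦X⟧)

noncomputable instance : Module ℂ⟦X⟧ (RankOne lam) := inferInstanceAs (Module ℂ⟦X⟧ ℂ⟦X⟧)

/-- The operator `a` of `E_lam`, on `ℂ[[b]]`. -/
noncomputable def aHom : ℂ⟦X⟧ →+ ℂ⟦X⟧ where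
  toFun S := C lam * X * S + X ^ 2 * derivative ℂ S
  map_zero' := by simp
  map_add' S T := by rw [map_add]; ring

theorem aHom_comm (S : ℂ⟦X⟧) : aHom lam (X * S) - X * aHom lam S = X ^ 2 * S := by
  simp only [aHom, AddMonoidHom.coe_mk, ZeroHom.coe_mk, Derivation.leibniz, derivative_X,
    smul_eq_mul]
  ring

noncomputable instance : ABModule (RankOne lam) where
  free := inferInstanceAs (Module.Free ℂ⟦X⟧ ℂ⟦X⟧)
  finite := inferInstanceAs (Module.Finite ℂ⟦X⟧ ℂ⟦X⟧)
  a := (aHom lam : ℂ⟦X⟧ →+ ℂ⟦X⟧)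
  a_const c S := by
    have h : ∀ T : ℂ⟦X⟧, aHom lam (C c * T) = C c * aHom lam T := fun T => by
      simp only [aHom, AddMonoidHom.coe_mk, ZeroHom.coe_mk, Derivation.leibniz, derivative_C,
        smul_eq_mul]
      ring
    exact h S
  a_continuous := continuous_of_comm (E := RankOne lam) (aHom_comm lam)
  a_b := aHom_comm lam

end RankOne

/-- The underlying group of `Hom_{a,b}(E, F)`: the `ℂ[[b]]`-linear maps from `E` to `F`. -/
def HomAB (E F : Type*) [AddCommGroup E] [Module ℂ⟦X⟧ E] [AddCommGroup F] [Module ℂ⟦X⟧ F] :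
    Type _ := E →ₗ[ℂ⟦X⟧] F

namespace HomAB

variable (E F : Type*) [AddCommGroup E] [Module ℂ⟦X⟧ E] [AddCommGroup F] [Module ℂ⟦X⟧ F]

noncomputable instance : AddCommGroup (HomAB E F) := inferInstanceAs (AddCommGroup (E →ₗ[ℂ⟦X⟧] F))

/-- The action of `ℂ[[b]]` on `Hom_{a,b}(E, F)`: `S(b)` acts as `S(-b)`. -/
noncomputable instance : Module ℂ⟦X⟧ (HomAB E F) :=
  Module.compHom (E →ₗ[ℂ⟦X⟧] F) (evalNegHom : ℂ⟦X⟧ →+* ℂ⟦X⟧)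

theorem evalNegHom_evalNegHom (S : ℂ⟦X⟧) : evalNegHom (evalNegHom S) = S := by
  ext n
  simp [evalNegHom, coeff_rescale, ← mul_assoc, ← mul_pow]

instance : RingHomInvPair (evalNegHom : ℂ⟦X⟧ →+* ℂ⟦X⟧) (evalNegHom : ℂ⟦X⟧ →+* ℂ⟦X⟧) where
  comp_eq := RingHom.ext evalNegHom_evalNegHom
  comp_eq₂ := RingHom.ext evalNegHom_evalNegHom

/-- The identity, as a semilinear bijection over `b ↦ -b`. -/
noncomputable def ofLinear : (E →ₗ[ℂ⟦X⟧] F) ≃ₛₗ[(evalNegHom : ℂ⟦X⟧ →+* ℂ⟦X⟧)] HomAB E F where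
  toFun φ := φ
  invFun φ := φ
  map_add' _ _ := rfl
  map_smul' S φ := congrArg (fun T : ℂ⟦X⟧ => T • φ) (evalNegHom_evalNegHom S).symm
  left_inv _ := rfl
  right_inv _ := rfl

variable [ABModule E] [ABModule F]

variable {E F} in
/-- `Λ(φ)(e) = φ(a e) - a φ(e)`. -/
noncomputable def lambdaMap (φ : E →ₗ[ℂ⟦X⟧] F) : E →ₗ[ℂ⟦X⟧] F where
  toFun e := φ (a e) - a (φ e)
  map_add' x y := by simp only [map_add]; abel
  map_smul' S x := by
    simp only [a_smul, map_add, map_smul, RingHom.id_apply, smul_sub]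
    abel

/-- The operator `a` of `Hom_{a,b}(E, F)`, equal to `Λ`. -/
noncomputable def aHom : (E →ₗ[ℂ⟦X⟧] F) →+ (E →ₗ[ℂ⟦X⟧] F) where
  toFun := lambdaMap
  map_zero' := by ext x; simp [lambdaMap]
  map_add' φ ψ := by
    ext x
    simp only [lambdaMap, LinearMap.coe_mk, AddHom.coe_mk, LinearMap.add_apply, map_add]
    abel

theorem aHom_comm (φ : E →ₗ[ℂ⟦X⟧] F) :
    aHom E F (evalNegHom (X : ℂ⟦X⟧) • φ) - evalNegHom (X : ℂ⟦X⟧) • aHom E F φ =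
      evalNegHom ((X : ℂ⟦X⟧) ^ 2) • φ := by
  ext x
  have h := a_b (φ x)
  rw [sub_eq_iff_eq_add] at h
  simp only [map_pow, evalNegHom_X, aHom, lambdaMap, AddMonoidHom.coe_mk, ZeroHom.coe_mk,
    LinearMap.sub_apply, LinearMap.smul_apply]
  change (-X : ℂ⟦X⟧) • φ (a x) - a ((-X : ℂ⟦X⟧) • φ x) - (-X : ℂ⟦X⟧) • (φ (a x) - a (φ x)) = _
  simp only [neg_smul, map_neg, h, neg_sq, smul_sub]
  abel

theorem aHom_const (c : ℂ) (φ : E →ₗ[ℂ⟦X⟧] F) :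
    aHom E F (evalNegHom (C c : ℂ⟦X⟧) • φ) = evalNegHom (C c : ℂ⟦X⟧) • aHom E F φ := by
  have hc : evalNegHom (C c : ℂ⟦X⟧) = C c := by
    ext n
    rcases n with _ | n <;> simp [evalNegHom, coeff_rescale, coeff_C]
  rw [hc]
  ext x
  change (C c : ℂ⟦X⟧) • φ (a x) - a ((C c : ℂ⟦X⟧) • φ x) = (C c : ℂ⟦X⟧) • (φ (a x) - a (φ x))
  rw [a_const, smul_sub]

/-- The (a,b)-module `Hom_{a,b}(E, F)`. -/
noncomputable instance : ABModule (HomAB E F) where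
  free := Module.Free.of_equiv (ofLinear E F)
  finite := Module.Finite.of_surjective (ofLinear E F).toLinearMap (ofLinear E F).surjective
  a := (aHom E F : (E →ₗ[ℂ⟦X⟧] F) →+ (E →ₗ[ℂ⟦X⟧] F))
  a_const := aHom_const E F
  a_continuous := continuous_of_comm (E := HomAB E F) (aHom_comm E F)
  a_b := aHom_comm E F

end HomAB

/-- The dual `E^* = Hom_{a,b}(E, E_0)`. -/
abbrev Dual (E : Type*) [AddCommGroup E] [Module ℂ⟦X⟧ E] : Type _ := HomAB E (RankOne 0)

section Invariants

variable (E : Type*) [AddCommGroup E] [Module ℂ⟦X⟧ E] [ABModule E]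

/-- `b^N E ⊆ (a - lam b) E`. -/
def PowIncluded (lam : ℂ) (N : ℕ) : Prop :=
  ∀ x : E, ∃ y : E, (X : ℂ⟦X⟧) ^ N • x = a y - (C lam * X : ℂ⟦X⟧) • y

/-- `N(E, lam)`: the smallest integer such that `b^N E ⊆ (a - lam b) E` for all `N ≥ N(E, lam)`. -/
noncomputable def detIndex (lam : ℂ) : ℕ :=
  sInf {N₀ : ℕ | ∀ N, N₀ ≤ N → PowIncluded E lam N}

/-- `ℂ/ℤ`. -/
abbrev CModZ : Type := ℂ ⧸ AddSubgroup.zmultiples (1 : ℂ)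

/-- The minimum of the `mu` in the class `c` with a nonzero morphism `E_mu → E`. The elements of a
class modulo `ℤ` are ordered by, and determined by, their real parts; so the infimum is recorded by
its real part, with `inf ∅ = +∞`. -/
noncomputable def lamMin (c : CModZ) : EReal :=
  sInf {r : EReal | ∃ mu : ℂ, (mu : CModZ) = c ∧ r = (mu.re : EReal) ∧
    ∃ f : RankOne mu →ₗ[ℂ⟦X⟧] E, IsABMorphism f ∧ f ≠ 0}

/-- The supremum, recorded by its real part, of the `mu` in the class `c` with a nonzero morphism
`E → E_mu`, with `sup ∅ = -∞`. -/
noncomputable def lamMax (c : CModZ) : EReal :=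
  sSup {r : EReal | ∃ mu : ℂ, (mu : CModZ) = c ∧ r = (mu.re : EReal) ∧
    ∃ f : E →ₗ[ℂ⟦X⟧] RankOne mu, IsABMorphism f ∧ f ≠ 0}

/-- The width `L(E)`: the supremum over the classes in `ℂ/ℤ` of `lamMax - lamMin`. In `EReal`,
`-∞ - x = -∞` for all `x > -∞`, and `+∞ - x = +∞` for all `x < +∞`. -/
noncomputable def width : EReal := ⨆ c : CModZ, lamMax E c - lamMin E c

end Invariants

end ABModule

namespace ABModule

/-! On the saturation `saturation E` the operator θ = b⁻¹a satisfies θS = Sθ + bS', so it acts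
linearly on the fibre modulo b; call its eigenvalues there exponents. Linear forms on F are the
linear forms on E that kill the generator x of the image of E_λ. After the sign change b ↦ -b of the
dual, the goal is to solve φa - (b²d/db + λb)φ = b^N ψ among such forms.

Dividing by b turns this into an equation for φθ - (b d/db + λ)φ on the saturation. Coefficient by
coefficient, that operator (`logDual`) is onto as soon as no λ + m, m ≥ 0, is an exponent
(`logDual_surjective`), and multiplying φ by bⁿ shifts λ to λ + n. If λ + m is the largest exponent
in λ + ℤ, a fibre eigenvector lifts to a nonzero morphism E → E_{λ+m} (`exists_logDual_eq_zero`),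
and since λ is the minimum of its class, m ≤ L(E).

The passage between E and its saturation costs b^{or(E)} (`X_pow_regOrder_smul_mem`). The rank
enters through or(E) ≤ rank(E) - 1 (`regOrder_le`): x yields an exponent λ - j with j ≤ or(E), so m
≥ 1 - rank(E), and N leaves room for a solution φ divisible by b. On x the equation makes φ(x)
constant, hence zero, so φ descends to F. -/

theorem smul_leibniz {R M : Type*} [CommRing R] [AddCommGroup M] [Module R M]
    (X s ds S dS : R) (x y : M) :
    s • (S • y + (X ^ 2 * dS) • x) - (X ^ 2 * ds) • S • x =
      S • (s • y - (X ^ 2 * ds) • x) + (X * dS) • (X * s) • x := by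
  module

/-! ### The operator b⁻¹a on E[b⁻¹] and on the saturation -/

section Localization

variable (E : Type*) [AddCommGroup E] [Module ℂ⟦X⟧ E] [ABModule E]

/-- The canonical map `E → E[b⁻¹]`. -/
noncomputable abbrev toLoc : E →ₗ[ℂ⟦X⟧] Loc E :=
  LocalizedModule.mkLinearMap (Submonoid.powers (X : ℂ⟦X⟧)) E

variable {E}

theorem ne_zero_of_mem_powers_X {s : ℂ⟦X⟧} (hs : s ∈ Submonoid.powers (X : ℂ⟦X⟧)) : s ≠ 0 := by
  obtain ⟨n, rfl⟩ := hs
  exact pow_ne_zero n X_ne_zero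

instance : Module.IsTorsionFree ℂ⟦X⟧ (Loc E) := by
  refine Module.isTorsionFree_iff_smul_eq_zero.mpr fun r w => ?_
  induction w using LocalizedModule.induction_on with
  | h x s =>
    intro h
    rw [LocalizedModule.smul'_mk, ← LocalizedModule.zero_mk s, LocalizedModule.mk_eq] at h
    obtain ⟨u, h⟩ := h
    simp only [Submonoid.smul_def, smul_zero, smul_eq_zero, ne_zero_of_mem_powers_X u.2,
      ne_zero_of_mem_powers_X s.2, false_or] at h
    exact h.imp_right fun h => by rw [h, LocalizedModule.zero_mk]

theorem toLoc_injective : Function.Injective (toLoc E) := by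
  refine (injective_iff_map_eq_zero _).mpr fun x h => ?_
  rw [LocalizedModule.mkLinearMap_apply, ← LocalizedModule.zero_mk 1, LocalizedModule.mk_eq] at h
  obtain ⟨u, h⟩ := h
  simpa [Submonoid.smul_def, ne_zero_of_mem_powers_X u.2] using h

theorem binvA_mk (x : E) (s : Submonoid.powers (X : ℂ⟦X⟧)) :
    binvA E (LocalizedModule.mk x s) = LocalizedModule.mk
      ((s : ℂ⟦X⟧) • a x - ((X : ℂ⟦X⟧) ^ 2 * derivative ℂ (s : ℂ⟦X⟧)) • x)
      (⟨X, Submonoid.mem_powers _⟩ * s ^ 2) :=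
  rfl

omit [ABModule E] in
theorem exists_common_denominator (v w : Loc E) :
    ∃ (x y : E) (s : Submonoid.powers (X : ℂ⟦X⟧)),
      v = LocalizedModule.mk x s ∧ w = LocalizedModule.mk y s := by
  induction v, w using LocalizedModule.induction_on₂ with
  | h x y s t =>
    exact ⟨t • x, s • y, t * s, (LocalizedModule.mk_cancel_common_left t s x).symm,
      by rw [mul_comm, LocalizedModule.mk_cancel_common_left]⟩

omit [ABModule E] in
theorem mk_add_mk_same (x y : E) (s : Submonoid.powers (X : ℂ⟦X⟧)) :
    (LocalizedModule.mk (x + y) s : Loc E) = LocalizedModule.mk x s + LocalizedModule.mk y s := by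
  rw [LocalizedModule.mk_add_mk, ← smul_add, LocalizedModule.mk_cancel_common_left]

theorem binvA_add (v w : Loc E) : binvA E (v + w) = binvA E v + binvA E w := by
  obtain ⟨x, y, s, rfl, rfl⟩ := exists_common_denominator v w
  rw [← mk_add_mk_same, binvA_mk, binvA_mk, binvA_mk, ← mk_add_mk_same, map_add, smul_add, smul_add]
  congr 1
  abel

variable (E) in
/-- The operator `b⁻¹ a` of `E[b⁻¹]` as an additive endomorphism. -/
noncomputable def binvAEnd : AddMonoid.End (Loc E) :=
  AddMonoidHom.mk' (binvA E) binvA_add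

theorem binvAEnd_apply (w : Loc E) : binvAEnd E w = binvA E w := rfl

end Localization

/-- The Leibniz rule `θ S = S θ + b S'(b)`, satisfied by `b⁻¹ a`. -/
def IsLogDerivation {V : Type*} [AddCommGroup V] [Module ℂ⟦X⟧ V] (θ : AddMonoid.End V) : Prop :=
  ∀ (S : ℂ⟦X⟧) (v : V), θ (S • v) = S • θ v + (X * derivative ℂ S) • v

section Localization

variable {E : Type*} [AddCommGroup E] [Module ℂ⟦X⟧ E] [ABModule E]

omit [ABModule E] in
theorem mk_eq_mk_X_mul (x : E) (s : Submonoid.powers (X : ℂ⟦X⟧)) :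
    (LocalizedModule.mk x s : Loc E) =
      LocalizedModule.mk (((X : ℂ⟦X⟧) * s) • x) (⟨X, Submonoid.mem_powers _⟩ * s ^ 2) := by
  have h := LocalizedModule.mk_cancel_common_left
    (⟨X, Submonoid.mem_powers _⟩ * s : Submonoid.powers (X : ℂ⟦X⟧)) s x
  rw [Submonoid.smul_def, Submonoid.coe_mul, mul_assoc, ← pow_two] at h
  exact h.symm

theorem isLogDerivation_binvAEnd : IsLogDerivation (binvAEnd E) := by
  intro S w
  induction w using LocalizedModule.induction_on with
  | h x s =>
    have h : (X * derivative ℂ S) • (LocalizedModule.mk x s : Loc E) = LocalizedModule.mk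
        ((X * derivative ℂ S) • ((X : ℂ⟦X⟧) * s) • x) (⟨X, Submonoid.mem_powers _⟩ * s ^ 2) := by
      rw [← LocalizedModule.smul'_mk, ← mk_eq_mk_X_mul]
    rw [h, binvAEnd_apply, binvAEnd_apply, LocalizedModule.smul'_mk, binvA_mk, binvA_mk,
      LocalizedModule.smul'_mk, ← mk_add_mk_same, a_smul]
    congr 1
    exact smul_leibniz ..

theorem toLoc_a (x : E) : toLoc E (a x) = (X : ℂ⟦X⟧) • binvAEnd E (toLoc E x) := by
  rw [binvAEnd_apply, LocalizedModule.mkLinearMap_apply, LocalizedModule.mkLinearMap_apply,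
    binvA_mk, LocalizedModule.smul'_mk]
  simp only [OneMemClass.coe_one, one_smul, one_pow, mul_one, Derivation.map_one_eq_zero, mul_zero,
    zero_smul, sub_zero]
  exact (LocalizedModule.mk_cancel (⟨X, Submonoid.mem_powers _⟩ : Submonoid.powers (X : ℂ⟦X⟧))
    (a x)).symm

theorem range_toLoc_le_saturation : LinearMap.range (toLoc E) ≤ saturation E :=
  le_sInf fun _ h => h.1

theorem binvAEnd_mem_saturation {w : Loc E} (hw : w ∈ saturation E) :
    binvAEnd E w ∈ saturation E :=
  Submodule.mem_sInf.mpr fun W hW => hW.2 w (Submodule.mem_sInf.mp hw W hW)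

theorem saturation_le {W : Submodule ℂ⟦X⟧ (Loc E)} (h : LinearMap.range (toLoc E) ≤ W)
    (hW : ∀ w ∈ W, binvAEnd E w ∈ W) : saturation E ≤ W :=
  sInf_le ⟨h, hW⟩

/-- Finitely many generators have a common denominator. The exponent is crude here;
`X_pow_regOrder_smul_mem` sharpens it to or(E). -/
theorem exists_X_pow_smul_mem_range (hE : IsRegular E) :
    ∃ n : ℕ, ∀ w ∈ saturation E, (X : ℂ⟦X⟧) ^ n • w ∈ LinearMap.range (toLoc E) := by
  obtain ⟨T, hT⟩ := hE
  obtain ⟨⟨_, n, rfl⟩, h⟩ := IsLocalizedModule.exist_integer_multiples_of_finset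
    (Submonoid.powers (X : ℂ⟦X⟧)) (toLoc E) T
  refine ⟨n, fun w hw => ?_⟩
  rw [← hT] at hw
  have hle : Submodule.span ℂ⟦X⟧ (T : Set (Loc E)) ≤
      (LinearMap.range (toLoc E)).comap (LinearMap.lsmul ℂ⟦X⟧ (Loc E) (X ^ n)) :=
    Submodule.span_le.mpr fun v hv => h v hv
  exact hle hw

theorem finite_saturation (hE : IsRegular E) : Module.Finite ℂ⟦X⟧ (saturation E) :=
  Module.Finite.iff_fg.mpr hE

theorem free_saturation (hE : IsRegular E) : Module.Free ℂ⟦X⟧ (saturation E) :=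
  have := finite_saturation hE
  Module.free_of_finite_type_torsion_free'

/-- Multiplication by bⁿ embeds the saturation in E. -/
theorem finrank_saturation_le (hE : IsRegular E) :
    Module.finrank ℂ⟦X⟧ (saturation E) ≤ Module.finrank ℂ⟦X⟧ E := by
  obtain ⟨n, hn⟩ := exists_X_pow_smul_mem_range hE
  let e := LinearEquiv.ofInjective (toLoc E) toLoc_injective
  let f : saturation E →ₗ[ℂ⟦X⟧] LinearMap.range (toLoc E) :=
    LinearMap.codRestrict _ (LinearMap.lsmul ℂ⟦X⟧ (Loc E) (X ^ n) ∘ₗ (saturation E).subtype)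
      fun w => hn w w.2
  have hf : Function.Injective f := by
    refine (injective_iff_map_eq_zero f).mpr fun w hw => ?_
    have h : (X : ℂ⟦X⟧) ^ n • (w : Loc E) = 0 := congrArg Subtype.val hw
    exact Subtype.ext ((smul_eq_zero.mp h).resolve_left (pow_ne_zero n X_ne_zero))
  exact LinearMap.finrank_le_finrank_of_injective (f := e.symm.toLinearMap ∘ₗ f)
    (e.symm.injective.comp hf)

/-- The operator `b⁻¹ a` of the saturation. -/
noncomputable def satEnd (E : Type*) [AddCommGroup E] [Module ℂ⟦X⟧ E] [ABModule E] :
    AddMonoid.End (saturation E) :=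
  AddMonoidHom.mk' (fun w => ⟨binvAEnd E w, binvAEnd_mem_saturation w.2⟩)
    fun v w => Subtype.ext (map_add (binvAEnd E) (v : Loc E) w)

theorem isLogDerivation_satEnd : IsLogDerivation (satEnd E) := fun S w =>
  Subtype.ext (isLogDerivation_binvAEnd S (w : Loc E))

/-- The inclusion of `E` in its saturation. -/
noncomputable def toSat (E : Type*) [AddCommGroup E] [Module ℂ⟦X⟧ E] [ABModule E] :
    E →ₗ[ℂ⟦X⟧] saturation E :=
  LinearMap.codRestrict _ (toLoc E) fun x => range_toLoc_le_saturation ⟨x, rfl⟩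

theorem toSat_injective : Function.Injective (toSat E) := fun _ _ h =>
  toLoc_injective (congrArg Subtype.val h)

theorem toSat_a (x : E) : toSat E (a x) = (X : ℂ⟦X⟧) • satEnd E (toSat E x) :=
  Subtype.ext (toLoc_a x)

end Localization

/-! ### The sums L + θL + ⋯ + θⁿ⁻¹L -/

section IterSum

variable {V : Type*} [AddCommGroup V] [Module ℂ⟦X⟧ V] (θ : AddMonoid.End V)
  (L : Submodule ℂ⟦X⟧ V)

/-- The sum `L + θ L + ⋯ + θⁿ⁻¹ L`. -/
noncomputable def iterSum : ℕ → AddSubgroup V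
  | 0 => ⊥
  | n + 1 => iterSum n ⊔ L.toAddSubgroup.map (θ ^ n : AddMonoid.End V)

variable {θ L}

omit [Module ℂ⟦X⟧ V] in
theorem pow_succ_apply (θ : AddMonoid.End V) (n : ℕ) (v : V) :
    (θ ^ (n + 1)) v = θ ((θ ^ n) v) := by
  rw [pow_succ']
  rfl

theorem mem_iterSum_succ {n : ℕ} {v : V} :
    v ∈ iterSum θ L (n + 1) ↔ ∃ t ∈ iterSum θ L n, ∃ e ∈ L, t + (θ ^ n) e = v := by
  rw [iterSum, AddSubgroup.mem_sup]
  constructor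
  · rintro ⟨t, ht, _, ⟨e, he, rfl⟩, rfl⟩
    exact ⟨t, ht, e, he, rfl⟩
  · rintro ⟨t, ht, e, he, rfl⟩
    exact ⟨t, ht, _, ⟨e, he, rfl⟩, rfl⟩

theorem iterSum_mono : Monotone (iterSum θ L) :=
  monotone_nat_of_le_succ fun _ => le_sup_left

theorem iterate_mem_iterSum (n : ℕ) {e : V} (he : e ∈ L) : (θ ^ n) e ∈ iterSum θ L (n + 1) :=
  mem_iterSum_succ.mpr ⟨0, zero_mem _, e, he, zero_add _⟩

theorem apply_mem_iterSum_succ {n : ℕ} {v : V} (hv : v ∈ iterSum θ L n) :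
    θ v ∈ iterSum θ L (n + 1) := by
  induction n generalizing v with
  | zero =>
    rw [(hv : v = 0), map_zero]
    exact zero_mem _
  | succ n ih =>
    obtain ⟨t, ht, e, he, rfl⟩ := mem_iterSum_succ.mp hv
    rw [map_add, ← pow_succ_apply]
    exact add_mem (iterSum_mono (Nat.le_succ _) (ih ht)) (iterate_mem_iterSum _ he)

/-- Since θ is not linear, the sums are a priori only additive subgroups. The two claims need a
joint induction: scalars preserve the next sum because the commutator of S with θⁿ has lower order
in θ. -/
theorem smul_mem_iterSum_aux (hθ : IsLogDerivation θ) (n : ℕ) :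
    (∀ (S : ℂ⟦X⟧), ∀ v ∈ iterSum θ L n, S • v ∈ iterSum θ L n) ∧
      ∀ (S : ℂ⟦X⟧), ∀ e ∈ L, S • (θ ^ n) e - (θ ^ n) (S • e) ∈ iterSum θ L n := by
  induction n with
  | zero =>
    refine ⟨fun S v hv => ?_, fun S e _ => ?_⟩
    · rw [(hv : v = 0), smul_zero]
      exact zero_mem _
    · simp
  | succ n ih =>
    have hsmul : ∀ (S : ℂ⟦X⟧), ∀ v ∈ iterSum θ L (n + 1), S • v ∈ iterSum θ L (n + 1) := by
      intro S v hv
      obtain ⟨t, ht, e, he, rfl⟩ := mem_iterSum_succ.mp hv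
      exact mem_iterSum_succ.mpr
        ⟨_, add_mem (ih.1 S t ht) (ih.2 S e he), S • e, L.smul_mem S he, by rw [smul_add]; abel⟩
    refine ⟨hsmul, fun S e he => ?_⟩
    have h := sub_mem (apply_mem_iterSum_succ (ih.2 S e he))
      (hsmul (X * derivative ℂ S) _ (iterate_mem_iterSum n he))
    rw [map_sub, hθ] at h
    rw [pow_succ_apply, pow_succ_apply]
    convert h using 1
    abel

variable (L) in
/-- The sum `L + θ L + ⋯ + θⁿ⁻¹ L` as a submodule. -/
noncomputable def iterSubmodule (hθ : IsLogDerivation θ) (n : ℕ) : Submodule ℂ⟦X⟧ V where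
  __ := iterSum θ L n
  smul_mem' S v hv := (smul_mem_iterSum_aux hθ n).1 S v hv

theorem mem_iterSubmodule {hθ : IsLogDerivation θ} {n : ℕ} {v : V} :
    v ∈ iterSubmodule L hθ n ↔ v ∈ iterSum θ L n := Iff.rfl

theorem IsLogDerivation.X_pow_smul (hθ : IsLogDerivation θ) (n : ℕ) (v : V) :
    θ ((X : ℂ⟦X⟧) ^ n • v) = (X : ℂ⟦X⟧) ^ n • (θ v + n • v) := by
  rw [hθ, smul_add, smul_comm _ n v, derivative_pow, derivative_X, mul_one]
  congr 1
  rcases n with _ | n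
  · simp
  · rw [Nat.add_sub_cancel, ← Nat.cast_smul_eq_nsmul ℂ⟦X⟧, smul_smul]
    congr 1
    ring

theorem X_pow_smul_iterate_mem (hθ : IsLogDerivation θ) (hL : ∀ e ∈ L, (X : ℂ⟦X⟧) • θ e ∈ L)
    (n : ℕ) {e : V} (he : e ∈ L) : (X : ℂ⟦X⟧) ^ n • (θ ^ n) e ∈ L := by
  induction n with
  | zero => simpa using he
  | succ n ih =>
    have h := sub_mem (hL _ ih) (L.smul_mem X (L.smul_mem (n : ℂ⟦X⟧) ih))
    rw [hθ.X_pow_smul, smul_add, smul_add] at h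
    rw [pow_succ', mul_smul, pow_succ_apply]
    convert h using 1
    rw [Nat.cast_smul_eq_nsmul, smul_comm _ n]
    abel

theorem X_pow_smul_mem_of_mem_iterSum (hθ : IsLogDerivation θ)
    (hL : ∀ e ∈ L, (X : ℂ⟦X⟧) • θ e ∈ L) (n : ℕ) {v : V} (hv : v ∈ iterSum θ L (n + 1)) :
    (X : ℂ⟦X⟧) ^ n • v ∈ L := by
  induction n generalizing v with
  | zero =>
    obtain ⟨t, ht, e, he, rfl⟩ := mem_iterSum_succ.mp hv
    rw [(ht : t = 0)]
    simpa using he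
  | succ n ih =>
    obtain ⟨t, ht, e, he, rfl⟩ := mem_iterSum_succ.mp hv
    rw [smul_add]
    refine add_mem ?_ (X_pow_smul_iterate_mem hθ hL _ he)
    rw [pow_succ', mul_smul]
    exact L.smul_mem X (ih ht)

variable (θ) in
/-- The product `(θ + m) (θ + m + 1) ⋯ (θ + m + j - 1)`. -/
def ascIter (m : ℕ) : ℕ → AddMonoid.End V
  | 0 => 1
  | j + 1 => (θ + ((m + j : ℕ) : AddMonoid.End V)) * ascIter m j

omit [Module ℂ⟦X⟧ V] in
theorem ascIter_succ_apply (m j : ℕ) (v : V) :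
    ascIter θ m (j + 1) v = θ (ascIter θ m j v) + (m + j) • ascIter θ m j v := by
  change θ (ascIter θ m j v) + ((m + j : ℕ) : AddMonoid.End V) (ascIter θ m j v) = _
  rw [AddMonoid.End.natCast_apply]

/-- `ascIter θ m j` is a monic polynomial of degree j in θ. -/
theorem ascIter_sub_iterate_mem (m j : ℕ) {e : V} (he : e ∈ L) :
    ascIter θ m j e - (θ ^ j) e ∈ iterSum θ L j := by
  induction j with
  | zero => simp [ascIter]
  | succ j ih =>
    have h : ascIter θ m j e ∈ iterSum θ L (j + 1) := by
      have := add_mem (iterSum_mono (Nat.le_succ j) ih) (iterate_mem_iterSum j he)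
      rwa [sub_add_cancel] at this
    have h' := add_mem (apply_mem_iterSum_succ ih) (nsmul_mem h (m + j))
    rw [map_sub] at h'
    rw [ascIter_succ_apply, pow_succ_apply]
    convert h' using 1
    abel

theorem ascIter_mem (m j : ℕ) {e : V} (he : e ∈ L) : ascIter θ m j e ∈ iterSum θ L (j + 1) := by
  have := add_mem (iterSum_mono (Nat.le_succ j) (ascIter_sub_iterate_mem (θ := θ) m j he))
    (iterate_mem_iterSum j he)
  rwa [sub_add_cancel] at this

/-- A triangular change from powers of θ to monic polynomials, peeled off from the top degree. The
shift may depend on j, as it does in `RegOrderLE`. -/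
theorem exists_sum_ascIter (m : ℕ → ℕ) (n : ℕ) {v : V} (hv : v ∈ iterSum θ L n) :
    ∃ y : ℕ → L, v = ∑ j ∈ Finset.range n, ascIter θ (m j) j (y j) := by
  induction n generalizing v with
  | zero => exact ⟨0, hv⟩
  | succ n ih =>
    obtain ⟨t, ht, e, he, rfl⟩ := mem_iterSum_succ.mp hv
    obtain ⟨y, hy⟩ := ih (sub_mem ht (ascIter_sub_iterate_mem (m n) n he))
    refine ⟨Function.update y n ⟨e, he⟩, ?_⟩
    rw [Finset.sum_range_succ, Function.update_self]
    have h : ∑ j ∈ Finset.range n, ascIter θ (m j) j (Function.update y n ⟨e, he⟩ j : L) =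
        ∑ j ∈ Finset.range n, ascIter θ (m j) j (y j) :=
      Finset.sum_congr rfl fun j hj => by
        rw [Function.update_of_ne (Finset.mem_range.mp hj).ne]
    rw [h, ← hy]
    abel

/-- From a = bθ and θbᵖ = bᵖ(θ + p): each a adds one power of b and one factor θ + p. -/
theorem map_iterate_X_pow_smul {E : Type*} [AddCommGroup E] [Module ℂ⟦X⟧ E] [ABModule E]
    (hθ : IsLogDerivation θ) {ι : E →ₗ[ℂ⟦X⟧] V} (hι : ∀ x, ι (a x) = (X : ℂ⟦X⟧) • θ (ι x))
    (m j : ℕ) (x : E) :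
    ι ((⇑(a : E →+ E))^[j] ((X : ℂ⟦X⟧) ^ m • x)) = (X : ℂ⟦X⟧) ^ (m + j) • ascIter θ m j (ι x) := by
  induction j with
  | zero => simp [ascIter]
  | succ j ih =>
    rw [Function.iterate_succ_apply', hι, ih, hθ.X_pow_smul, ascIter_succ_apply, smul_smul,
      ← pow_succ', add_assoc]

end IterSum

/-! ### Generation of the saturation in fewer steps than the rank -/

section GerardLevelt

variable {M : Type*} [AddCommGroup M] [Module ℂ⟦X⟧ M] [Module.Free ℂ⟦X⟧ M]
  [Module.Finite ℂ⟦X⟧ M] {θ : AddMonoid.End M}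

omit [Module.Free ℂ⟦X⟧ M] [Module.Finite ℂ⟦X⟧ M] in
theorem apply_basis_sum (hθ : IsLogDerivation θ) {ι : Type*} [Fintype ι]
    (B : Module.Basis ι ℂ⟦X⟧ M) (v : M) :
    θ v = ∑ i, B.repr v i • θ (B i) + (X : ℂ⟦X⟧) • ∑ i, derivative ℂ (B.repr v i) • B i := by
  conv_lhs => rw [← B.sum_repr v]
  rw [map_sum, Finset.smul_sum, ← Finset.sum_add_distrib]
  exact Finset.sum_congr rfl fun i _ => by rw [hθ, mul_smul]

/-- The Leibniz defect is divisible by b. The map θ₀ lifts the action of θ on M/bM, so that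
Cayley–Hamilton applies to it. -/
theorem exists_linear_eq_mod_X (hθ : IsLogDerivation θ) :
    ∃ θ₀ : Module.End ℂ⟦X⟧ M, ∀ v, ∃ w, θ v = θ₀ v + (X : ℂ⟦X⟧) • w := by
  let B := Module.finBasis ℂ⟦X⟧ M
  refine ⟨B.constr ℂ⟦X⟧ fun i => θ (B i), fun v =>
    ⟨∑ i, derivative ℂ (B.repr v i) • B i, ?_⟩⟩
  rw [Module.Basis.constr_apply_fintype]
  exact apply_basis_sum hθ B v

omit [Module.Free ℂ⟦X⟧ M] [Module.Finite ℂ⟦X⟧ M] in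
theorem exists_iterate_eq_mod_X (hθ : IsLogDerivation θ) {θ₀ : Module.End ℂ⟦X⟧ M}
    (h : ∀ v, ∃ w, θ v = θ₀ v + (X : ℂ⟦X⟧) • w) (n : ℕ) (v : M) :
    ∃ w, (θ ^ n) v = (θ₀ ^ n) v + (X : ℂ⟦X⟧) • w := by
  induction n with
  | zero => exact ⟨0, by simp⟩
  | succ n ih =>
    obtain ⟨w, hw⟩ := ih
    obtain ⟨w', hw'⟩ := h ((θ₀ ^ n) v)
    refine ⟨w' + (θ w + w), ?_⟩
    have hX := hθ.X_pow_smul 1 w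
    rw [pow_one, one_smul] at hX
    rw [pow_succ_apply, hw, map_add, hw', hX, pow_succ', Module.End.mul_apply,
      smul_add, smul_add, smul_add, add_assoc]

theorem exists_pow_finrank_eq (θ₀ : Module.End ℂ⟦X⟧ M) :
    ∃ c : ℕ → ℂ⟦X⟧, ∀ v, (θ₀ ^ Module.finrank ℂ⟦X⟧ M) v =
      ∑ i ∈ Finset.range (Module.finrank ℂ⟦X⟧ M), c i • (θ₀ ^ i) v := by
  refine ⟨fun i => -θ₀.charpoly.coeff i, fun v => ?_⟩
  have h := congrArg (fun f : Module.End ℂ⟦X⟧ M => f v) θ₀.aeval_self_charpoly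
  have hc : θ₀.charpoly.coeff (Module.finrank ℂ⟦X⟧ M) = 1 := by
    rw [← θ₀.charpoly_natDegree]
    exact θ₀.charpoly_monic
  simp only [Polynomial.aeval_eq_sum_range, θ₀.charpoly_natDegree, Finset.sum_range_succ, hc,
    one_smul, LinearMap.add_apply, LinearMap.sum_apply, LinearMap.smul_apply,
    LinearMap.zero_apply] at h
  rw [eq_neg_of_add_eq_zero_right h]
  simp [Finset.sum_neg_distrib]

/-- The saturation of `L` is the sum of `θⁱ L` for `i` less than the rank. -/
theorem iterSubmodule_finrank_eq_top (hθ : IsLogDerivation θ) (L : Submodule ℂ⟦X⟧ M)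
    (hL : ∀ W : Submodule ℂ⟦X⟧ M, L ≤ W → (∀ w ∈ W, θ w ∈ W) → W = ⊤) :
    iterSubmodule L hθ (Module.finrank ℂ⟦X⟧ M) = ⊤ := by
  set s := Module.finrank ℂ⟦X⟧ M with hs
  obtain ⟨θ₀, hθ₀⟩ := exists_linear_eq_mod_X hθ
  obtain ⟨c, hc⟩ := exists_pow_finrank_eq θ₀
  set U := iterSubmodule L hθ s with hU
  let W : Submodule ℂ⟦X⟧ M := U ⊔ LinearMap.range (LinearMap.lsmul ℂ⟦X⟧ M X)
  have hUW : U ≤ W := le_sup_left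
  have hXW : ∀ w, (X : ℂ⟦X⟧) • w ∈ W := fun w => Submodule.mem_sup_right ⟨w, rfl⟩
  -- Cayley–Hamilton for θ₀ expresses θˢ modulo b by lower powers of θ; this makes U + bM stable
  -- under θ.
  have hpow : ∀ e ∈ L, (θ ^ s) e ∈ W := by
    intro e he
    obtain ⟨w, hw⟩ := exists_iterate_eq_mod_X hθ hθ₀ s e
    rw [hw, hc]
    refine add_mem (sum_mem fun i hi => W.smul_mem _ ?_) (hXW w)
    obtain ⟨w', hw'⟩ := exists_iterate_eq_mod_X hθ hθ₀ i e
    rw [← sub_eq_iff_eq_add] at hw'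
    rw [← hw']
    exact sub_mem (hUW (iterSum_mono (Finset.mem_range.mp hi) (iterate_mem_iterSum i he))) (hXW w')
  have hW : W = ⊤ := by
    refine hL W (fun e he => ?_) fun w hw => ?_
    · rcases Nat.eq_zero_or_pos s with h0 | h0
      · simpa [h0] using hpow e he
      · exact hUW (iterSum_mono h0 (by simpa using iterate_mem_iterSum (θ := θ) 0 he))
    · obtain ⟨u, hu, _, ⟨w, rfl⟩, rfl⟩ := Submodule.mem_sup.mp hw
      obtain ⟨t, ht, e, he, h⟩ := mem_iterSum_succ.mp (apply_mem_iterSum_succ hu)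
      rw [map_add, ← h, LinearMap.lsmul_apply, ← pow_one (X : ℂ⟦X⟧), hθ.X_pow_smul, pow_one]
      exact add_mem (add_mem (hUW ht) (hpow e he)) (hXW _)
  -- Nakayama's lemma: U + bM = M forces U = M.
  refine top_le_iff.mp (Submodule.le_of_le_smul_of_le_jacobson_bot
    (I := Ideal.span {(X : ℂ⟦X⟧)}) Module.Finite.fg_top ?_ ?_)
  · rw [IsLocalRing.jacobson_eq_maximalIdeal ⊥ bot_ne_top]
    exact IsLocalRing.le_maximalIdeal
      (by rw [Ne, Ideal.span_singleton_eq_top]; exact X_prime.not_isUnit)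
  · rw [← hW]
    refine sup_le le_sup_left (le_sup_of_le_right ?_)
    rintro _ ⟨w, rfl⟩
    exact Submodule.smul_mem_smul (Ideal.mem_span_singleton_self X) (by rw [hW]; trivial)

end GerardLevelt

/-! ### The regularity order read on the saturation -/

section RegOrder

variable {E : Type*} [AddCommGroup E] [Module ℂ⟦X⟧ E] [ABModule E]

theorem eq_top_of_range_toSat_le (W : Submodule ℂ⟦X⟧ (saturation E))
    (h : LinearMap.range (toSat E) ≤ W) (hW : ∀ w ∈ W, satEnd E w ∈ W) : W = ⊤ := by
  have hle : saturation E ≤ W.map (saturation E).subtype := by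
    refine saturation_le ?_ ?_
    · rintro _ ⟨x, rfl⟩
      exact ⟨toSat E x, h ⟨x, rfl⟩, rfl⟩
    · rintro _ ⟨w, hw, rfl⟩
      exact ⟨satEnd E w, hW w hw, rfl⟩
  refine eq_top_iff.mpr fun w _ => ?_
  obtain ⟨w', hw', h⟩ := hle w.2
  rwa [← Subtype.ext h]

variable (E) in
/-- The condition `a^{k+1} E ⊆ ∑_{j=0}^{k} a^j b^{k-j+1} E`. -/
def RegOrderLE (k : ℕ) : Prop :=
  ∀ x : E, ∃ y : ℕ → E, (⇑(a : E →+ E))^[k + 1] x =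
    ∑ j ∈ Finset.range (k + 1), (⇑(a : E →+ E))^[j] ((X : ℂ⟦X⟧) ^ (k - j + 1) • y j)

theorem toSat_iterate (k : ℕ) (x : E) : toSat E ((⇑(a : E →+ E))^[k + 1] x) =
    (X : ℂ⟦X⟧) ^ (k + 1) • ascIter (satEnd E) 0 (k + 1) (toSat E x) := by
  have := map_iterate_X_pow_smul isLogDerivation_satEnd toSat_a 0 (k + 1) x
  rwa [pow_zero, one_smul, zero_add] at this

theorem toSat_sum_iterate (k : ℕ) (y : ℕ → E) :
    toSat E (∑ j ∈ Finset.range (k + 1), (⇑(a : E →+ E))^[j] ((X : ℂ⟦X⟧) ^ (k - j + 1) • y j)) =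
      (X : ℂ⟦X⟧) ^ (k + 1) • ∑ j ∈ Finset.range (k + 1),
        ascIter (satEnd E) (k - j + 1) j (toSat E (y j)) := by
  rw [map_sum, Finset.smul_sum]
  refine Finset.sum_congr rfl fun j hj => ?_
  rw [map_iterate_X_pow_smul isLogDerivation_satEnd toSat_a]
  congr 2
  have := Finset.mem_range.mp hj
  omega

/-- Both sides of the inclusion defining `RegOrderLE` carry the factor b^{k+1}. Cancelling it leaves
monic polynomials in θ, which may be replaced by powers modulo lower degrees. -/
theorem regOrderLE_iff (k : ℕ) : RegOrderLE E k ↔ ∀ x : E,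
    ((satEnd E) ^ (k + 1)) (toSat E x) ∈
      iterSum (satEnd E) (LinearMap.range (toSat E)) (k + 1) := by
  refine forall_congr' fun x => ?_
  have hx : ascIter (satEnd E) 0 (k + 1) (toSat E x) - ((satEnd E) ^ (k + 1)) (toSat E x) ∈
      iterSum (satEnd E) (LinearMap.range (toSat E)) (k + 1) := ascIter_sub_iterate_mem _ _ ⟨x, rfl⟩
  constructor
  · rintro ⟨y, hy⟩
    have h := congrArg (toSat E) hy
    rw [toSat_iterate, toSat_sum_iterate] at h
    have h' := smul_right_injective _ (pow_ne_zero (k + 1) (X_ne_zero (R := ℂ))) h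
    have hm := sum_mem fun j (hj : j ∈ Finset.range (k + 1)) =>
      iterSum_mono (Finset.mem_range.mp hj) (ascIter_mem (θ := satEnd E)
        (L := LinearMap.range (toSat E)) (k - j + 1) j ⟨y j, rfl⟩)
    simpa only [← h', sub_sub_cancel] using sub_mem hm hx
  · intro h
    have h' := add_mem hx h
    rw [sub_add_cancel] at h'
    obtain ⟨y, hy⟩ := exists_sum_ascIter (fun j => k - j + 1) (k + 1) h'
    choose z hz using fun j => (y j).2
    refine ⟨z, toSat_injective ?_⟩
    rw [toSat_iterate, toSat_sum_iterate, hy]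
    simp only [hz]

theorem regOrderLE_finrank_sub_one (hE : IsRegular E) (h : 0 < Module.finrank ℂ⟦X⟧ E) :
    RegOrderLE E (Module.finrank ℂ⟦X⟧ E - 1) := by
  have := finite_saturation hE
  have := free_saturation hE
  rw [regOrderLE_iff, Nat.sub_add_cancel h]
  intro x
  refine iterSum_mono (finrank_saturation_le hE) ?_
  rw [← mem_iterSubmodule (hθ := isLogDerivation_satEnd), iterSubmodule_finrank_eq_top
    isLogDerivation_satEnd _ eq_top_of_range_toSat_le]
  trivial

theorem regOrder_le (hE : IsRegular E) (h : 0 < Module.finrank ℂ⟦X⟧ E) :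
    regOrder E ≤ Module.finrank ℂ⟦X⟧ E - 1 :=
  Nat.sInf_le (regOrderLE_finrank_sub_one hE h)

/-- With k = or(E), the sum of the θʲE for j ≤ k is stable under θ, hence is the whole saturation;
and bᵏ carries it into E because bʲθʲE ⊂ E. -/
theorem X_pow_regOrder_smul_mem (hE : IsRegular E) (h : 0 < Module.finrank ℂ⟦X⟧ E)
    (w : saturation E) : (X : ℂ⟦X⟧) ^ regOrder E • w ∈ LinearMap.range (toSat E) := by
  -- The bound by the rank shows that the set defining `regOrder` is nonempty, so its infimum is
  -- attained and is not the default 0.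
  have hk : RegOrderLE E (regOrder E) :=
    Nat.sInf_mem (s := {k | RegOrderLE E k}) ⟨_, regOrderLE_finrank_sub_one hE h⟩
  rw [regOrderLE_iff] at hk
  have htop : iterSubmodule (LinearMap.range (toSat E)) isLogDerivation_satEnd (regOrder E + 1) =
      ⊤ := by
    refine eq_top_of_range_toSat_le _ (fun e he => ?_) fun w hw => ?_
    · exact iterSum_mono (Nat.le_add_left 1 _)
        (by simpa using iterate_mem_iterSum (θ := satEnd E) 0 he)
    · obtain ⟨t, ht, _, ⟨e, rfl⟩, h⟩ := mem_iterSum_succ.mp (apply_mem_iterSum_succ hw)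
      rw [← h]
      exact add_mem ht (hk e)
  refine X_pow_smul_mem_of_mem_iterSum isLogDerivation_satEnd ?_ _ (htop ▸ Submodule.mem_top :
    w ∈ iterSubmodule (LinearMap.range (toSat E)) isLogDerivation_satEnd (regOrder E + 1))
  rintro _ ⟨x, rfl⟩
  exact ⟨a x, toSat_a x⟩

end RegOrder

theorem exists_strong_recursion {α : Type*} (step : ∀ m : ℕ, (Fin m → α) → α) :
    ∃ f : ℕ → α, ∀ m, f m = step m fun k => f k :=
  ⟨fun m => Nat.strongRec (motive := fun _ => α) (fun m ih => step m fun k => ih k k.2) m,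
    fun m => Nat.strongRec_eq _ m⟩

theorem X_mul_derivative_X_pow_mul (n : ℕ) (S : ℂ⟦X⟧) :
    X * derivative ℂ (X ^ n * S) = X ^ n * (X * derivative ℂ S + (n : ℂ⟦X⟧) * S) := by
  rw [Derivation.leibniz, derivative_pow, derivative_X, smul_eq_mul, smul_eq_mul]
  rcases n with _ | n
  · simp
  · rw [Nat.add_sub_cancel]
    ring

theorem coeff_X_mul_derivative (m : ℕ) (S : ℂ⟦X⟧) :
    coeff m (X * derivative ℂ S) = m * coeff m S := by
  rcases m with _ | m
  · simp
  · rw [coeff_succ_X_mul, coeff_derivative]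
    push_cast
    ring

/-! ### Exponents and the differential equation on linear forms -/

section LogDual

variable {M : Type*} [AddCommGroup M] [Module ℂ⟦X⟧ M] {θ : AddMonoid.End M}

/-- The operator `φ ↦ φ θ - (b d/db + μ) φ` on the linear forms. -/
noncomputable def logDual (hθ : IsLogDerivation θ) (μ : ℂ) (φ : M →ₗ[ℂ⟦X⟧] ℂ⟦X⟧) :
    M →ₗ[ℂ⟦X⟧] ℂ⟦X⟧ where
  toFun v := φ (θ v) - (X * derivative ℂ (φ v) + C μ * φ v)
  map_add' v w := by
    simp only [map_add]
    ring
  map_smul' S v := by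
    simp only [hθ S v, map_add, map_smul, smul_eq_mul, Derivation.leibniz, RingHom.id_apply]
    ring

theorem logDual_apply (hθ : IsLogDerivation θ) (μ : ℂ) (φ : M →ₗ[ℂ⟦X⟧] ℂ⟦X⟧) (v : M) :
    logDual hθ μ φ v = φ (θ v) - (X * derivative ℂ (φ v) + C μ * φ v) := rfl

theorem logDual_sub (hθ : IsLogDerivation θ) (μ : ℂ) (φ ψ : M →ₗ[ℂ⟦X⟧] ℂ⟦X⟧) :
    logDual hθ μ (φ - ψ) = logDual hθ μ φ - logDual hθ μ ψ := by
  ext1 v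
  simp only [logDual_apply, LinearMap.sub_apply, map_sub]
  ring

theorem logDual_X_pow_smul (hθ : IsLogDerivation θ) (μ : ℂ) (n : ℕ) (φ : M →ₗ[ℂ⟦X⟧] ℂ⟦X⟧) :
    logDual hθ μ ((X : ℂ⟦X⟧) ^ n • φ) = (X : ℂ⟦X⟧) ^ n • logDual hθ (μ + n) φ := by
  ext1 v
  simp only [logDual_apply, LinearMap.smul_apply, smul_eq_mul, X_mul_derivative_X_pow_mul, map_add,
    map_natCast]
  ring

variable {ι : Type*} (B : Module.Basis ι ℂ⟦X⟧ M)

variable (θ) in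
/-- The action of `θ` on `M / b M`, transposed, in a basis. -/
noncomputable def fiberMatrix : Matrix ι ι ℂ :=
  Matrix.of fun i j => constantCoeff (B.repr (θ (B i)) j)

variable [Fintype ι] [DecidableEq ι]

variable (θ) in
/-- The number `μ` is an eigenvalue of `θ` on `M / b M`. -/
def IsExponent (μ : ℂ) : Prop := (fiberMatrix θ B).charpoly.IsRoot μ

theorem isExponent_iff {μ : ℂ} :
    IsExponent θ B μ ↔ (Matrix.scalar ι μ - fiberMatrix θ B).det = 0 := by
  rw [IsExponent, Polynomial.IsRoot, Matrix.eval_charpoly]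

theorem isExponent_bounded (μ : ℂ) : ∃ b : ℤ, ∀ m : ℤ, IsExponent θ B (μ + m) → m ≤ b := by
  have hfin : {x | (fiberMatrix θ B).charpoly.IsRoot x}.Finite :=
    Polynomial.finite_setOfPred_isRoot (fiberMatrix θ B).charpoly_monic.ne_zero
  have hinj : Function.Injective fun m : ℤ => μ + (m : ℂ) := fun m n h =>
    Int.cast_injective (add_left_cancel h)
  obtain ⟨b, hb⟩ := (hfin.preimage hinj.injOn).bddAbove
  exact ⟨b, fun m hm => hb hm⟩

theorem scalar_sub_fiberMatrix_mulVec (μ : ℂ) (u : ι → ℂ) (i : ι) :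
    ((Matrix.scalar ι μ - fiberMatrix θ B).mulVec u) i =
      μ * u i - ∑ j, u j * constantCoeff (B.repr (θ (B i)) j) := by
  rw [Matrix.sub_mulVec, Pi.sub_apply, Matrix.scalar_apply, Matrix.mulVec_diagonal]
  congr 1
  exact Finset.sum_congr rfl fun j _ => mul_comm _ _

/-- The system is triangular: the m-th coefficients of the form enter only through the fibre matrix
minus μ + m, the rest being determined by earlier coefficients. -/
theorem coeff_logDual_constr (hθ : IsLogDerivation θ) (μ : ℂ) (f : ι → ℂ⟦X⟧) (m : ℕ) (i : ι) :
    coeff m (logDual hθ μ (B.constr ℂ⟦X⟧ f) (B i)) =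
      ∑ k ∈ Finset.range m, ∑ j, coeff k (f j) * coeff (m - k) (B.repr (θ (B i)) j) -
        ((Matrix.scalar ι (μ + m) - fiberMatrix θ B).mulVec fun j => coeff m (f j)) i := by
  have h : coeff m (B.constr ℂ⟦X⟧ f (θ (B i))) =
      ∑ k ∈ Finset.range (m + 1), ∑ j, coeff k (f j) * coeff (m - k) (B.repr (θ (B i)) j) := by
    rw [Module.Basis.constr_apply_fintype, map_sum, Finset.sum_comm]
    refine Finset.sum_congr rfl fun j _ => ?_
    rw [smul_eq_mul, mul_comm, coeff_mul, Finset.Nat.sum_antidiagonal_eq_sum_range_succ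
      fun p q => coeff p (f j) * coeff q (B.equivFun (θ (B i)) j)]
    rfl
  rw [logDual_apply, Module.Basis.constr_basis, map_sub, map_add, coeff_X_mul_derivative,
    coeff_C_mul, h, Finset.sum_range_succ, scalar_sub_fiberMatrix_mulVec]
  simp only [Nat.sub_self, coeff_zero_eq_constantCoeff_apply]
  ring

theorem logDual_surjective (hθ : IsLogDerivation θ) {μ : ℂ}
    (h : ∀ m : ℕ, ¬ IsExponent θ B (μ + m)) : Function.Surjective (logDual hθ μ) := by
  intro ψ
  let R : ℕ → Matrix ι ι ℂ := fun m => Matrix.scalar ι (μ + m) - fiberMatrix θ B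
  obtain ⟨f, hf⟩ := exists_strong_recursion (α := ι → ℂ) fun m prev => (R m)⁻¹.mulVec fun i =>
    ∑ k : Fin m, ∑ j, prev k j * coeff (m - k) (B.repr (θ (B i)) j) - coeff m (ψ (B i))
  have hR : ∀ m, (R m).mulVec (f m) = fun i =>
      ∑ k : Fin m, ∑ j, f k j * coeff (m - k) (B.repr (θ (B i)) j) - coeff m (ψ (B i)) := by
    intro m
    have hdet : IsUnit (R m).det := isUnit_iff_ne_zero.mpr fun h0 =>
      h m ((isExponent_iff B).mpr h0)
    conv_lhs => rw [hf m]
    rw [Matrix.mulVec_mulVec, Matrix.mul_nonsing_inv _ hdet, Matrix.one_mulVec]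
  refine ⟨B.constr ℂ⟦X⟧ fun i => PowerSeries.mk fun m => f m i, B.ext fun i => ?_⟩
  ext m
  rw [coeff_logDual_constr]
  simp only [coeff_mk]
  rw [show (fun j => f m j) = f m from rfl, hR m, Finset.sum_range]
  ring

/-- A fibre eigenvector, lifted with constant coefficients to φ₀, solves the equation modulo b. The
error b·g is removed by bφ₁, where φ₁ solves the equation at μ + 1, beyond every exponent μ + m with
m ≥ 0. -/
theorem exists_logDual_eq_zero (hθ : IsLogDerivation θ) {μ : ℂ} (h0 : IsExponent θ B μ)
    (h : ∀ m : ℕ, ¬ IsExponent θ B (μ + 1 + m)) :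
    ∃ φ : M →ₗ[ℂ⟦X⟧] ℂ⟦X⟧, φ ≠ 0 ∧ logDual hθ μ φ = 0 := by
  obtain ⟨u, hu, hu0⟩ := Matrix.exists_mulVec_eq_zero_iff.mpr ((isExponent_iff B).mp h0)
  let φ₀ : M →ₗ[ℂ⟦X⟧] ℂ⟦X⟧ := B.constr ℂ⟦X⟧ fun i => C (u i)
  have hdvd : ∀ i, (X : ℂ⟦X⟧) ∣ logDual hθ μ φ₀ (B i) := by
    intro i
    rw [X_dvd_iff, ← coeff_zero_eq_constantCoeff_apply, coeff_logDual_constr]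
    simpa using congrFun hu0 i
  choose g hg using hdvd
  obtain ⟨φ₁, h₁⟩ := logDual_surjective B hθ h (B.constr ℂ⟦X⟧ g)
  refine ⟨φ₀ - (X : ℂ⟦X⟧) ^ 1 • φ₁, fun hφ => hu (funext fun i => ?_), ?_⟩
  · have := congrArg (fun φ : M →ₗ[ℂ⟦X⟧] ℂ⟦X⟧ => constantCoeff (φ (B i))) hφ
    simpa [φ₀] using this
  · rw [logDual_sub, logDual_X_pow_smul, Nat.cast_one, h₁, sub_eq_zero]
    refine B.ext fun i => ?_
    rw [hg, pow_one, LinearMap.smul_apply, Module.Basis.constr_basis, smul_eq_mul]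

/-- The class of y modulo b is a nonzero eigenvector in the fibre. `fiberMatrix` being transposed,
it acts there on row vectors. -/
theorem isExponent_of_eigenvector (hθ : IsLogDerivation θ) {μ : ℂ} {y : M}
    (hy : θ y = (C μ : ℂ⟦X⟧) • y) (hX : ∀ w, y ≠ (X : ℂ⟦X⟧) • w) : IsExponent θ B μ := by
  rw [isExponent_iff, ← Matrix.exists_vecMul_eq_zero_iff]
  refine ⟨fun i => constantCoeff (B.repr y i), fun h => ?_, ?_⟩
  · have hdvd : ∀ i, (X : ℂ⟦X⟧) ∣ B.repr y i := fun i => X_dvd_iff.mpr (congrFun h i)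
    choose g hg using hdvd
    refine hX (∑ i, g i • B i) ?_
    conv_lhs => rw [← B.sum_repr y]
    rw [Finset.smul_sum]
    exact Finset.sum_congr rfl fun i _ => by rw [hg, mul_smul]
  · ext j
    have h := congrArg (fun v => constantCoeff (B.repr v j)) hy
    rw [apply_basis_sum hθ B y] at h
    simp only [map_add, map_sum, map_smul, Finsupp.add_apply, Finsupp.smul_apply, smul_eq_mul,
      Finsupp.finsetSum_apply, map_mul, constantCoeff_X, zero_mul, add_zero, constantCoeff_C] at h
    rw [Matrix.vecMul_sub, Pi.sub_apply, Matrix.scalar_apply, Matrix.vecMul_diagonal, Pi.zero_apply,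
      sub_eq_zero, mul_comm, ← h]
    rfl

end LogDual

/-! ### The largest exponent is bounded by the width -/

section Width

variable {E : Type*} [AddCommGroup E] [Module ℂ⟦X⟧ E] [ABModule E]

/-- A linear form as a linear map to `E_μ`. -/
def toRankOne (μ : ℂ) {M : Type*} [AddCommGroup M] [Module ℂ⟦X⟧ M] (f : M →ₗ[ℂ⟦X⟧] ℂ⟦X⟧) :
    M →ₗ[ℂ⟦X⟧] RankOne μ := f

theorem isABMorphism_of_logDual_eq_zero {μ : ℂ} {φ : saturation E →ₗ[ℂ⟦X⟧] ℂ⟦X⟧}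
    (hφ : logDual isLogDerivation_satEnd μ φ = 0) :
    IsABMorphism (toRankOne μ (φ ∘ₗ toSat E)) := by
  intro x
  have h := congrArg (fun f : saturation E →ₗ[ℂ⟦X⟧] ℂ⟦X⟧ => X * f (toSat E x)) hφ
  simp only [logDual_apply, LinearMap.zero_apply, mul_zero] at h
  change φ (toSat E (a x)) = C μ * X * φ (toSat E x) + X ^ 2 * derivative ℂ (φ (toSat E x))
  rw [toSat_a, map_smul, smul_eq_mul]
  linear_combination h

theorem comp_toSat_ne_zero (hE : IsRegular E) {φ : saturation E →ₗ[ℂ⟦X⟧] ℂ⟦X⟧} (hφ : φ ≠ 0) :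
    φ ∘ₗ toSat E ≠ 0 := by
  intro h
  obtain ⟨n, hn⟩ := exists_X_pow_smul_mem_range hE
  refine hφ (LinearMap.ext fun w => ?_)
  obtain ⟨x, hx⟩ := hn w w.2
  have hw : (X : ℂ⟦X⟧) ^ n • w = toSat E x := Subtype.ext hx.symm
  have h' : (X : ℂ⟦X⟧) ^ n • φ w = 0 := by
    rw [← map_smul, hw]
    exact LinearMap.congr_fun h x
  exact (smul_eq_zero.mp h').resolve_left (pow_ne_zero n X_ne_zero)

/-- The single class of λ already contributes at least (λ + m) - λ to the supremum. -/
theorem le_width_of_morphism {lam : ℂ}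
    (hlam : lamMin E (lam : CModZ) = (lam.re : EReal)) {m : ℤ}
    {f : E →ₗ[ℂ⟦X⟧] RankOne (lam + m)} (hf : IsABMorphism f) (hf0 : f ≠ 0) :
    ((m : ℝ) : EReal) ≤ width E := by
  have hmax : (((lam + m : ℂ).re : ℝ) : EReal) ≤ lamMax E (lam : CModZ) := by
    refine le_sSup ⟨lam + m, ?_, rfl, f, hf, hf0⟩
    rw [QuotientAddGroup.eq_iff_sub_mem]
    exact AddSubgroup.mem_zmultiples_iff.mpr ⟨m, by simp⟩
  refine le_trans ?_ (le_iSup (fun c => lamMax E c - lamMin E c) (lam : CModZ))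
  refine le_trans ?_ (EReal.sub_le_sub hmax hlam.le)
  rw [← EReal.coe_sub, EReal.coe_le_coe_iff]
  simp

theorem le_width_of_isExponent (hE : IsRegular E) {lam : ℂ}
    (hlam : lamMin E (lam : CModZ) = (lam.re : EReal)) {ι : Type*} [Fintype ι] [DecidableEq ι]
    (B : Module.Basis ι ℂ⟦X⟧ (saturation E)) {m : ℤ} (hm : IsExponent (satEnd E) B (lam + m))
    (hmax : ∀ n : ℤ, IsExponent (satEnd E) B (lam + n) → n ≤ m) :
    ((m : ℝ) : EReal) ≤ width E := by
  obtain ⟨φ, hφ0, hφ⟩ := exists_logDual_eq_zero B isLogDerivation_satEnd hm fun n hn => by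
    have := hmax (m + 1 + n) (by push_cast; rwa [← add_assoc, ← add_assoc])
    omega
  exact le_width_of_morphism hlam (f := toRankOne _ (φ ∘ₗ toSat E))
    (isABMorphism_of_logDual_eq_zero hφ)
    (comp_toSat_ne_zero hE hφ0)

end Width

/-! ### Eigenvectors, extension of forms and solution of the equation -/

section Eigenvector

variable {M : Type*} [AddCommGroup M] [Module ℂ⟦X⟧ M] [Module.IsTorsionFree ℂ⟦X⟧ M]
  {θ : AddMonoid.End M}

/-- An eigenvector divided by a power of `b` is an eigenvector, for a smaller eigenvalue. -/
theorem IsLogDerivation.eigenvector_of_X_pow_smul (hθ : IsLogDerivation θ) {μ : ℂ} {j : ℕ} {y : M}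
    (h : θ ((X : ℂ⟦X⟧) ^ j • y) = (C μ : ℂ⟦X⟧) • (X : ℂ⟦X⟧) ^ j • y) :
    θ y = (C (μ - j) : ℂ⟦X⟧) • y := by
  rw [hθ.X_pow_smul, smul_comm] at h
  have h' := smul_right_injective _ (pow_ne_zero j (X_ne_zero (R := ℂ))) h
  rw [map_sub, sub_smul, ← h', map_natCast, Nat.cast_smul_eq_nsmul, add_sub_cancel_right]

end Eigenvector

section Extension

variable {E : Type*} [AddCommGroup E] [Module ℂ⟦X⟧ E] [ABModule E]

theorem satEnd_toSat_of_a_eq {μ : ℂ} {x : E} (hx : a x = (C μ * X : ℂ⟦X⟧) • x) :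
    satEnd E (toSat E x) = (C μ : ℂ⟦X⟧) • toSat E x := by
  have h := toSat_a x
  rw [hx, map_smul, mul_comm, mul_smul] at h
  exact (smul_right_injective _ (X_ne_zero (R := ℂ)) h).symm

/-- An eigenvector of `E` not divisible by `b` yields an exponent of the saturation. -/
theorem exists_isExponent (hE : IsRegular E) (hr : 0 < Module.finrank ℂ⟦X⟧ E) {lam : ℂ} {x : E}
    (hx : a x = (C lam * X : ℂ⟦X⟧) • x) (hX : ∀ z, x ≠ (X : ℂ⟦X⟧) • z)
    {ι : Type*} [Fintype ι] [DecidableEq ι] (B : Module.Basis ι ℂ⟦X⟧ (saturation E)) :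
    ∃ j ≤ regOrder E, IsExponent (satEnd E) B (lam - j) := by
  classical
  let P : ℕ → Prop := fun j => ∃ y, toSat E x = (X : ℂ⟦X⟧) ^ j • y
  -- If x = bʲy with j > or(E), then b^{or(E)}y lies in E and x would be divisible by b in E.
  have hP : ∀ j, P j → j ≤ regOrder E := by
    rintro j ⟨y, hy⟩
    by_contra! hj
    obtain ⟨z, hz⟩ := X_pow_regOrder_smul_mem hE hr y
    refine hX ((X : ℂ⟦X⟧) ^ (j - regOrder E - 1) • z) (toSat_injective ?_)
    rw [map_smul, map_smul, hz, hy, smul_smul, smul_smul, ← pow_succ', ← pow_add]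
    congr 2
    omega
  have h0 : P 0 := ⟨toSat E x, by simp⟩
  obtain ⟨y, hy⟩ : P (Nat.findGreatest P (regOrder E)) := Nat.findGreatest_spec (Nat.zero_le _) h0
  refine ⟨Nat.findGreatest P (regOrder E), Nat.findGreatest_le _, ?_⟩
  refine isExponent_of_eigenvector B isLogDerivation_satEnd (y := y) ?_ fun w hw => ?_
  · refine isLogDerivation_satEnd.eigenvector_of_X_pow_smul ?_
    rw [← hy]
    exact satEnd_toSat_of_a_eq hx
  · have h1 : P (Nat.findGreatest P (regOrder E) + 1) :=
      ⟨w, by rw [hy, hw, pow_succ, mul_smul, ← hw]⟩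
    have := Nat.le_findGreatest (hP _ h1) h1
    omega

/-- The linear forms on `E` extend to the saturation after multiplication by `b^{or(E)}`. -/
theorem exists_extension (hE : IsRegular E) (hr : 0 < Module.finrank ℂ⟦X⟧ E)
    (ψ : E →ₗ[ℂ⟦X⟧] ℂ⟦X⟧) :
    ∃ φ : saturation E →ₗ[ℂ⟦X⟧] ℂ⟦X⟧, ∀ x, φ (toSat E x) = X ^ regOrder E * ψ x := by
  let e := LinearEquiv.ofInjective (toSat E) toSat_injective
  let m : saturation E →ₗ[ℂ⟦X⟧] LinearMap.range (toSat E) :=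
    LinearMap.codRestrict _ (LinearMap.lsmul ℂ⟦X⟧ (saturation E) (X ^ regOrder E))
      (X_pow_regOrder_smul_mem hE hr)
  refine ⟨ψ ∘ₗ e.symm.toLinearMap ∘ₗ m, fun x => ?_⟩
  have h : m (toSat E x) = (X : ℂ⟦X⟧) ^ regOrder E • e x := rfl
  rw [LinearMap.comp_apply, LinearMap.comp_apply, h, LinearEquiv.coe_coe, map_smul,
    LinearEquiv.symm_apply_apply, map_smul, smul_eq_mul]

/-- Solution of `φ a - a φ = b^N ψ` for the linear forms on `E`, where `a` acts on `ℂ[[b]]` as on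
`E_lam`; the solution vanishes on the eigenvectors killed by `ψ`. -/
theorem exists_solution (hE : IsRegular E) {lam : ℂ}
    (hlam : lamMin E (lam : CModZ) = (lam.re : EReal)) {x : E}
    (hx : a x = (C lam * X : ℂ⟦X⟧) • x) (hX : ∀ z, x ≠ (X : ℂ⟦X⟧) • z) {N : ℕ}
    (hN : (regOrder E : EReal) + width E + (Module.finrank ℂ⟦X⟧ E : EReal) + 1 ≤ (N : EReal))
    (ψ : E →ₗ[ℂ⟦X⟧] ℂ⟦X⟧) (hψ : ψ x = 0) :
    ∃ φ : E →ₗ[ℂ⟦X⟧] ℂ⟦X⟧, φ x = 0 ∧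
      ∀ e, φ (a e) - (X ^ 2 * derivative ℂ (φ e) + C lam * X * φ e) = X ^ N * ψ e := by
  have hr : 0 < Module.finrank ℂ⟦X⟧ E := by
    have : Nontrivial E := ⟨x, 0, fun h => hX 0 (by rw [h, smul_zero])⟩
    exact Module.finrank_pos
  have := finite_saturation hE
  have := free_saturation hE
  let B := Module.finBasis ℂ⟦X⟧ (saturation E)
  obtain ⟨j, hj, hjB⟩ := exists_isExponent hE hr hx hX B
  obtain ⟨m, hm, hmax⟩ := Int.exists_greatest_of_bdd (isExponent_bounded (θ := satEnd E) B lam)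
    ⟨-(j : ℤ), by push_cast; rwa [← sub_eq_add_neg]⟩
  have hjm := hmax (-(j : ℤ)) (by push_cast; rwa [← sub_eq_add_neg])
  have hk := regOrder_le hE hr
  have hNm : (regOrder E : ℤ) + m + Module.finrank ℂ⟦X⟧ E + 1 ≤ N := by
    have hw := le_width_of_isExponent hE hlam B hm hmax
    have h : (((regOrder E + m + Module.finrank ℂ⟦X⟧ E + 1 : ℤ) : ℝ) : EReal) ≤ ((N : ℝ) : EReal) := by
      refine le_trans (le_of_eq ?_) (le_trans (add_le_add_left (add_le_add_left
        (add_le_add_right hw (regOrder E : EReal)) (Module.finrank ℂ⟦X⟧ E : EReal)) 1) hN)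
      push_cast
      simp
    rw [EReal.coe_le_coe_iff] at h
    exact_mod_cast h
  -- N ≥ or(E) + 2 because m ≥ -j ≥ -or(E) ≥ 1 - rank(E). Of the powers of b, or(E) serve to extend
  -- ψ, one comes from a = bθ, and n + 1 ≥ 1 remain as a factor of φ.
  obtain ⟨n, rfl⟩ : ∃ n, N = n + 1 + 1 + regOrder E := ⟨N - 2 - regOrder E, by omega⟩
  obtain ⟨ψ', hψ'⟩ := exists_extension hE hr ψ
  -- Here n + 1 ≥ m + rank(E) > m, so λ + n + 1 is beyond the last exponent.
  obtain ⟨φ₁, hφ₁⟩ := logDual_surjective B isLogDerivation_satEnd (μ := lam + (n + 1 : ℕ))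
    (fun i hi => by
      have := hmax (n + 1 + i) (by push_cast at hi ⊢; rwa [← add_assoc])
      omega) ψ'
  let φ : saturation E →ₗ[ℂ⟦X⟧] ℂ⟦X⟧ := (X : ℂ⟦X⟧) ^ (n + 1) • φ₁
  have hφ : ∀ w, φ (satEnd E w) - (X * derivative ℂ (φ w) + C lam * φ w) =
      X ^ (n + 1) * ψ' w := by
    intro w
    rw [← logDual_apply isLogDerivation_satEnd, logDual_X_pow_smul, hφ₁]
    rfl
  refine ⟨φ ∘ₗ toSat E, ?_, fun e => ?_⟩
  · have h := hφ (toSat E x)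
    rw [satEnd_toSat_of_a_eq hx, map_smul, hψ', hψ, mul_zero, mul_zero, smul_eq_mul] at h
    -- As x has eigenvalue λ, the terms in λ cancel and only b d/db is left; φ(x) is then a constant
    -- divisible by b.
    have hd : derivative ℂ (φ (toSat E x)) = 0 :=
      (mul_eq_zero.mp (show X * derivative ℂ (φ (toSat E x)) = 0 by
        linear_combination -h)).resolve_left X_ne_zero
    refine derivative.ext (by rw [LinearMap.comp_apply, hd, map_zero]) ?_
    change constantCoeff (X ^ (n + 1) * φ₁ (toSat E x)) = constantCoeff 0
    simp
  · rw [LinearMap.comp_apply, LinearMap.comp_apply, toSat_a, map_smul, smul_eq_mul]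
    have h := hφ (toSat E e)
    rw [hψ'] at h
    linear_combination X * h

theorem evalNegHom_C (c : ℂ) : evalNegHom (C c : ℂ⟦X⟧) = C c := by
  ext n
  rcases n with _ | n <;> simp [evalNegHom, coeff_rescale, coeff_C]

/-- A linear map which vanishes on the kernel of a surjection to a projective module factors. -/
theorem exists_factor {R M P Q : Type*} [CommRing R] [AddCommGroup M] [Module R M]
    [AddCommGroup P] [Module R P] [Module.Projective R P] [AddCommGroup Q] [Module R Q]
    (β : M →ₗ[R] P) (hβ : Function.Surjective β) (φ : M →ₗ[R] Q)
    (h : ∀ x, β x = 0 → φ x = 0) : ∃ φ' : P →ₗ[R] Q, ∀ x, φ' (β x) = φ x := by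
  obtain ⟨σ, hσ⟩ := Module.projective_lifting_property β LinearMap.id hβ
  refine ⟨φ ∘ₗ σ, fun x => ?_⟩
  rw [LinearMap.comp_apply, ← sub_eq_zero, ← map_sub]
  refine h _ ?_
  rw [map_sub, sub_eq_zero]
  exact LinearMap.congr_fun hσ (β x)

theorem powIncluded_dual {F : Type*} [AddCommGroup F] [Module ℂ⟦X⟧ F] [ABModule F] {lam : ℂ} {N : ℕ}
    (h : ∀ ψ : F →ₗ[ℂ⟦X⟧] ℂ⟦X⟧, ∃ φ : F →ₗ[ℂ⟦X⟧] ℂ⟦X⟧, ∀ f,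
      φ (a f) - (X ^ 2 * derivative ℂ (φ f) + C lam * X * φ f) = X ^ N * ψ f) :
    PowIncluded (Dual F) (-lam) N := by
  intro ψ
  let ψ₀ : F →ₗ[ℂ⟦X⟧] ℂ⟦X⟧ := ψ
  -- On the dual, b^N acts as (-b)^N; the sign is absorbed in the right-hand side.
  obtain ⟨φ, hφ⟩ := h ((-1 : ℂ⟦X⟧) ^ N • ψ₀)
  refine ⟨(φ : F →ₗ[ℂ⟦X⟧] ℂ⟦X⟧), LinearMap.ext fun f => ?_⟩
  change evalNegHom ((X : ℂ⟦X⟧) ^ N) * ψ₀ f =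
    (φ (a f) - (C 0 * X * φ f + X ^ 2 * derivative ℂ (φ f))) - evalNegHom (C (-lam) * X) * φ f
  have h' := hφ f
  rw [LinearMap.smul_apply, smul_eq_mul] at h'
  rw [map_pow, map_mul, evalNegHom_X, evalNegHom_C, map_zero, map_neg, neg_pow]
  linear_combination -h'

end Extension

end ABModule

/-! ### Descent to the quotient F -/

theorem mainTheorem11 {E F : Type*}
    [AddCommGroup E] [Module ℂ⟦X⟧ E] [ABModule E]
    [AddCommGroup F] [Module ℂ⟦X⟧ F] [ABModule F]
    (hE : ABModule.IsRegular E)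
    (lam : ℂ) (hlam : ABModule.lamMin E (lam : ABModule.CModZ) = (lam.re : EReal))
    (α : ABModule.RankOne lam →ₗ[ℂ⟦X⟧] E) (β : E →ₗ[ℂ⟦X⟧] F)
    (hα : ABModule.IsABMorphism α) (hβ : ABModule.IsABMorphism β)
    (hinj : Function.Injective α) (hexact : Function.Exact α β) (hsurj : Function.Surjective β)
    (N : ℕ)
    (hN : (ABModule.regOrder E : EReal) + ABModule.width E + (Module.finrank ℂ⟦X⟧ E : EReal) + 1 ≤
      (N : EReal)) :
    ABModule.detIndex (ABModule.Dual F) (-lam) ≤ N ∧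
      ABModule.PowIncluded (ABModule.Dual F) (-lam) N := by
  let one : ABModule.RankOne lam := (1 : ℂ⟦X⟧)
  have hone : ∀ s : ABModule.RankOne lam, ∃ S : ℂ⟦X⟧, s = S • one := fun s =>
    ⟨(s : ℂ⟦X⟧), (@mul_one ℂ⟦X⟧ _ s).symm⟩
  have ha : ABModule.a one = (C lam * X : ℂ⟦X⟧) • one := by
    change C lam * X * 1 + X ^ 2 * derivative ℂ (1 : ℂ⟦X⟧) = C lam * X * (1 : ℂ⟦X⟧)
    rw [Derivation.map_one_eq_zero, mul_zero, add_zero]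
  have hx : ABModule.a (α one) = (C lam * X : ℂ⟦X⟧) • α one := by rw [← hα, ha, map_smul]
  have hβα : ∀ s, β (α s) = 0 := fun s => (hexact (α s)).mpr ⟨s, rfl⟩
  -- F is torsion-free, so such a z would come from E_λ, and 1 would be divisible by b.
  have hX : ∀ z, α one ≠ (X : ℂ⟦X⟧) • z := by
    intro z hz
    have h := hβα one
    rw [hz, map_smul, smul_eq_zero] at h
    obtain ⟨s, rfl⟩ := (hexact z).mp (h.resolve_left X_ne_zero)
    obtain ⟨S, rfl⟩ := hone s
    rw [← map_smul] at hz
    have h1 : (1 : ℂ⟦X⟧) = X * (S * 1) := hinj hz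
    simpa using congrArg constantCoeff h1
  have key : ABModule.PowIncluded (ABModule.Dual F) (-lam) N := by
    refine ABModule.powIncluded_dual fun ψ => ?_
    obtain ⟨φ, hφx, hφ⟩ := ABModule.exists_solution hE hlam hx hX hN (ψ ∘ₗ β)
      (by rw [LinearMap.comp_apply, hβα, map_zero])
    obtain ⟨φ', hφ'⟩ := ABModule.exists_factor β hsurj φ fun e he => by
      obtain ⟨s, rfl⟩ := (hexact e).mp he
      obtain ⟨S, rfl⟩ := hone s
      rw [map_smul, map_smul, hφx, smul_zero]
    refine ⟨φ', fun f => ?_⟩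
    obtain ⟨e, rfl⟩ := hsurj f
    rw [← hβ, hφ', hφ']
    exact hφ e
  -- The inclusion for N gives it for every n ≥ N, by applying it to b^{n-N}x.
  refine ⟨Nat.sInf_le fun n hn x => ?_, key⟩
  obtain ⟨y, hy⟩ := key ((X : ℂ⟦X⟧) ^ (n - N) • x)
  exact ⟨y, by rw [← hy, smul_smul, ← pow_add, Nat.add_sub_cancel' hn]⟩
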